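/- Let $T:\Omega\to\Omega$ be a homeomorphism of a compact metric space, $\mu$ a $T$-ergodic Borel probability measure on $\Omega$, and $f:\Omega\to\mathbb R$ continuous. For $\omega\in\Omega$ let $H_\omega$ be the bounded self-adjoint operator on $\ell^2(\mathbb Z)$ given by $$[H_\omega\psi](n)=\psi(n+1)+\psi(n-1)+f(T^n\omega)\,\psi(n).$$ There is a compact set $\Sigma\subset\mathbb R$ with $\sigma(H_\omega)=\Sigma$ for $\mu$-almost every $\omega$; put $E_{\max}=\max\Sigma$. For $E\in\mathbb R$ let $$A_E:\Omega\to \mathrm{SL}(2,\mathbb R),\qquad A_E(\omega)=\begin{pmatrix}E-f(\omega)&-1\\1&0\end{pmatrix},$$ and for $n\in\mathbb Z$ define $A_E^n$ by $(T,A_E)^n=(T^n,A_E^n)$, where $(T,A_E)$ is the skew product $(\omega,v)\mapsto(T\omega,A_E(\omega)v)$ on $\Omega\times\mathbb R^2$. Suppose that there are $c\in\mathbb R$ and a continuous map $W:\Omega\to\mathrm{SL}(2,\mathbb R)$ such that for all $\omega\in\Omega$ $$W(T\omega)^{-1}A_{E_{\max}}(\omega)W(\omega)=\begin{pmatrix}1&c\\0&1\end{pmatrix}.$$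 Then $c\neq0$. Suppose in addition that $\mu$ has full support (as is the case whenever $T$ is minimal) or, more generally, that $\sigma(H_\omega)\subset(-\infty,E_{\max}]$ for every $\omega\in\Omega$. Then there are a compact cone $C$ in the open first quadrant of $\mathbb R^2$ (a convex cone with apex $0$, with compact set of directions, such that $C\setminus\{0\}\subset(0,\infty)^2$) and a continuous map $b:\Omega\to C\setminus\{0\}$ such that (i) $[b(T\omega)]=[A_{E_{\max}}(\omega)b(\omega)]$ for every $\omega\in\Omega$, where $[\cdot]:\mathbb R^2\setminus\{0\}\to\mathbb{RP}^1$ is the canonical projection; (ii) for every $\omega\in\Omega$, the sequence $(A_{E_{\max}}^n(\omega)b(\omega))_{n\in\mathbb Z}$ is bounded. -/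

import Mathlib

open MeasureTheory
open scoped ENNReal lp

namespace DynSchrodinger

noncomputable section

/-- The Hilbert space `ℓ²(ℤ)`. -/
abbrev EllTwo : Type := lp (fun _ : ℤ => ℂ) 2

/-! ### The discrete Schrödinger operator with a bounded potential -/

theorem memlp_shift (k : ℤ) (ψ : EllTwo) :
    Memℓp (fun n : ℤ => ψ (n + k)) 2 := by
  refine memℓp_gen ?_
  have h := (lp.memℓp ψ).summable (by norm_num)
  exact (Equiv.addRight k).summable_iff.mpr h

theorem norm_shift (k : ℤ) (ψ : EllTwo) :
    ‖(⟨fun n : ℤ => ψ (n + k), memlp_shift k ψ⟩ : EllTwo)‖ = ‖ψ‖ := by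
  rw [lp.norm_eq_tsum_rpow (by norm_num), lp.norm_eq_tsum_rpow (by norm_num)]
  congr 1
  exact (Equiv.addRight k).tsum_eq (fun n => ‖ψ n‖ ^ (2 : ℝ≥0∞).toReal)

/-- The translation `ψ ↦ ψ(· + k)` on `ℓ²(ℤ)`. -/
def shift (k : ℤ) : EllTwo →L[ℂ] EllTwo :=
  LinearMap.mkContinuous
    { toFun := fun ψ => ⟨fun n : ℤ => ψ (n + k), memlp_shift k ψ⟩
      map_add' := fun _ _ => rfl
      map_smul' := fun _ _ => rfl } 1
    (fun ψ => by
      rw [one_mul]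
      exact (norm_shift k ψ).le)

theorem memlp_mul (V : ℤ → ℝ) (M : ℝ) (hV : ∀ n, |V n| ≤ M) (ψ : EllTwo) :
    Memℓp (fun n : ℤ => (V n : ℂ) * ψ n) 2 := by
  refine ((lp.memℓp ψ).const_smul (M : ℂ)).mono' ?_
  intro n
  have hM : 0 ≤ M := (abs_nonneg _).trans (hV n)
  simp only [Pi.smul_apply, smul_eq_mul, norm_mul, Complex.norm_real, Real.norm_eq_abs,
    abs_of_nonneg hM]
  exact mul_le_mul_of_nonneg_right (hV n) (norm_nonneg _)

/-- Multiplication by a bounded real potential on `ℓ²(ℤ)`. -/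
def mulPotential (V : ℤ → ℝ) (M : ℝ) (hV : ∀ n, |V n| ≤ M) : EllTwo →L[ℂ] EllTwo :=
  LinearMap.mkContinuous
    { toFun := fun ψ => ⟨fun n : ℤ => (V n : ℂ) * ψ n, memlp_mul V M hV ψ⟩
      map_add' := fun ψ φ => by
        ext n
        exact mul_add _ _ _
      map_smul' := fun a ψ => by
        ext n
        exact mul_left_comm _ _ _ } M
    (fun ψ => by
      have hM : 0 ≤ M := (abs_nonneg _).trans (hV 0)
      have h : ‖(M : ℂ) • ψ‖ = M * ‖ψ‖ := by
        rw [norm_smul, Complex.norm_real, Real.norm_eq_abs, abs_of_nonneg hM]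
      rw [← h]
      refine lp.norm_mono (by norm_num) ?_
      intro n
      simp only [LinearMap.coe_mk, AddHom.coe_mk, lp.coeFn_smul, Pi.smul_apply, smul_eq_mul,
        norm_mul, Complex.norm_real, Real.norm_eq_abs, abs_of_nonneg hM]
      exact mul_le_mul_of_nonneg_right (hV n) (norm_nonneg _))

/-- The Schrödinger operator `[Hψ](n) = ψ(n+1) + ψ(n-1) + V(n) ψ(n)` on `ℓ²(ℤ)`. The bound `M`
only serves to make the operator bounded. -/
def schrodinger (V : ℤ → ℝ) (M : ℝ) (hV : ∀ n, |V n| ≤ M) : EllTwo →L[ℂ] EllTwo :=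
  shift 1 + shift (-1) + mulPotential V M hV

theorem schrodinger_apply (V : ℤ → ℝ) (M : ℝ) (hV : ∀ n, |V n| ≤ M) (ψ : EllTwo) (n : ℤ) :
    schrodinger V M hV ψ n = ψ (n + 1) + ψ (n - 1) + (V n : ℂ) * ψ n :=
  rfl

/-! ### Dynamically defined potentials -/

variable {Ω : Type*}

section Operators

variable [MetricSpace Ω] [CompactSpace Ω]

/-- The potential `V_ω(n) = f(Tⁿ ω)`. -/
def potential (T : Ω ≃ₜ Ω) (f : C(Ω, ℝ)) (ω : Ω) (n : ℤ) : ℝ := f ((T ^ n) ω)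

theorem abs_potential_le (T : Ω ≃ₜ Ω) (f : C(Ω, ℝ)) (ω : Ω) (n : ℤ) :
    |potential T f ω n| ≤ ‖f‖ :=
  f.norm_coe_le_norm _

/-- The operator `H_ω`. -/
def hamiltonian (T : Ω ≃ₜ Ω) (f : C(Ω, ℝ)) (ω : Ω) : EllTwo →L[ℂ] EllTwo :=
  schrodinger (potential T f ω) ‖f‖ (abs_potential_le T f ω)

/-- The spectrum `σ(H_ω)` as a subset of `ℝ` (`H_ω` is self-adjoint, so no spectrum is lost). -/
def spec (T : Ω ≃ₜ Ω) (f : C(Ω, ℝ)) (ω : Ω) : Set ℝ :=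
  {E : ℝ | (E : ℂ) ∈ spectrum ℂ (hamiltonian T f ω)}

/-- The almost sure spectrum `Σ`: the energies lying in `σ(H_ω)` for `μ`-almost every `ω`. Whenever
`σ(H_ω)` agrees almost surely with a fixed set, that set is `Σ`; see `asSpec_eq`. -/
def asSpec [MeasurableSpace Ω] (T : Ω ≃ₜ Ω) (f : C(Ω, ℝ)) (μ : Measure Ω) : Set ℝ :=
  {E : ℝ | ∀ᵐ ω ∂μ, E ∈ spec T f ω}

theorem asSpec_eq [MeasurableSpace Ω] (T : Ω ≃ₜ Ω) (f : C(Ω, ℝ)) (μ : Measure Ω)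
    [IsProbabilityMeasure μ] (S : Set ℝ) (hS : ∀ᵐ ω ∂μ, spec T f ω = S) :
    asSpec T f μ = S := by
  ext E
  constructor
  · intro hE
    have hE' : ∀ᵐ ω ∂μ, E ∈ spec T f ω := hE
    obtain ⟨ω, h1, h2⟩ := (hE'.and hS).exists
    exact h2 ▸ h1
  · intro hE
    filter_upwards [hS] with ω hω
    rw [hω]
    exact hE

/-- `E_max = max Σ`. -/
def Emax [MeasurableSpace Ω] (T : Ω ≃ₜ Ω) (f : C(Ω, ℝ)) (μ : Measure Ω) : ℝ :=
  sSup (asSpec T f μ)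

end Operators

/-! ### Cocycles -/

section Cocycles

variable [TopologicalSpace Ω]

/-- The Schrödinger cocycle map `A_E(ω) = [[E - f(ω), -1], [1, 0]]`. -/
def cocycleMap (f : C(Ω, ℝ)) (E : ℝ) (ω : Ω) : Matrix.SpecialLinearGroup (Fin 2) ℝ :=
  ⟨!![E - f ω, -1; 1, 0], by simp [Matrix.det_fin_two]⟩

/-- The skew product `(T, A) : (ω, v) ↦ (T ω, A(ω) v)` on `Ω × ℝ²`, an invertible map. -/
def skewProduct (T : Ω ≃ₜ Ω) (A : Ω → Matrix.SpecialLinearGroup (Fin 2) ℝ) :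
    Equiv.Perm (Ω × (Fin 2 → ℝ)) where
  toFun p := (T p.1, (A p.1).1.mulVec p.2)
  invFun p := (T.symm p.1, ((A (T.symm p.1))⁻¹).1.mulVec p.2)
  left_inv p := by
    have h : ((A p.1)⁻¹).1 * (A p.1).1 = 1 := by
      rw [← Matrix.SpecialLinearGroup.coe_mul, inv_mul_cancel, Matrix.SpecialLinearGroup.coe_one]
    ext1
    · simp
    · simp only [Homeomorph.symm_apply_apply, Matrix.mulVec_mulVec, h, Matrix.one_mulVec]
  right_inv p := by
    have h : (A (T.symm p.1)).1 * ((A (T.symm p.1))⁻¹).1 = 1 := by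
      rw [← Matrix.SpecialLinearGroup.coe_mul, mul_inv_cancel, Matrix.SpecialLinearGroup.coe_one]
    ext1
    · simp
    · simp only [Matrix.mulVec_mulVec, h, Matrix.one_mulVec]

/-- The iterate `Aⁿ(ω) v`, `n ∈ ℤ`, determined by `(T, A)ⁿ (ω, v) = (Tⁿ ω, Aⁿ(ω) v)`. -/
def iterate (T : Ω ≃ₜ Ω) (A : Ω → Matrix.SpecialLinearGroup (Fin 2) ℝ) (n : ℤ) (ω : Ω)
    (v : Fin 2 → ℝ) : Fin 2 → ℝ :=
  ((skewProduct T A ^ n) (ω, v)).2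

/-- The constant matrix `A_* = [[1, c], [0, 1]]`. -/
def parabolic (c : ℝ) : Matrix.SpecialLinearGroup (Fin 2) ℝ :=
  ⟨!![1, c; 0, 1], by simp [Matrix.det_fin_two]⟩

end Cocycles

/-- `C` is a compact cone in the open first quadrant of `ℝ²`: a convex cone with apex `0`, compact
in the sense that its set of directions (its trace on the unit sphere) is compact, all of whose
nonzero points lie in the open first quadrant. -/
structure IsCompactConeInQuadrant (C : Set (Fin 2 → ℝ)) : Prop where
  zero_mem : (0 : Fin 2 → ℝ) ∈ C
  convex : Convex ℝ C
  smul_mem : ∀ v ∈ C, ∀ t : ℝ, 0 ≤ t → t • v ∈ C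
  compact : IsCompact (C ∩ Metric.sphere (0 : Fin 2 → ℝ) 1)
  quadrant : ∀ v ∈ C, v ≠ 0 → 0 < v 0 ∧ 0 < v 1

end

end DynSchrodinger

/-! The condition $H_\omega\le q$, read as a bound on quadratic forms, is closed and $T$-invariant
in $\omega$. Ergodicity then gives $H_\omega\le E_{\max}$ almost surely (`ae_mem_lowSet_Emax`), and
full support upgrades this to every $\omega$.

The core is variational (`mul_pos_of_bounded`): if $H_\omega\le q$ and $u$ is a bounded half-line
solution at energy $q$ with $u_1\ne0$, then $u_0u_1>0$. Cut $u$ off slowly and replace $u_0$ by a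
free value $t$. Up to a vanishing error, the form inequality becomes $2tu_1-(q-V_0)t^2\le u_0u_1$,
and the left side is positive for small $t$ with the sign of $u_1$.

Every vector fixed by the parabolic matrix gives, through $W$, a bounded invariant section. If $c=0$
every vector is fixed, so some section takes the value $(1,0)$, which contradicts positivity. In
general $W(1,0)^{\mathsf T}$ has coordinates of equal strict sign; their absolute values form $b$,
and compactness of $\Omega$ gives the cone. -/

namespace DynSchrodinger

/-! ### Spectrum and numerical range of self-adjoint operators -/

section SelfAdjoint

variable {H : Type*} [NormedAddCommGroup H] [InnerProductSpace ℂ H] [CompleteSpace H]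

theorem le_algebraMap_iff_re_inner_le {a : H →L[ℂ] H} (ha : IsSelfAdjoint a) (q : ℝ) :
    a ≤ algebraMap ℝ (H →L[ℂ] H) q ↔ ∀ φ : H, (inner ℂ (a φ) φ).re ≤ q * ‖φ‖ ^ 2 := by
  have hsa : IsSelfAdjoint (algebraMap ℝ (H →L[ℂ] H) q - a) :=
    (IsSelfAdjoint.algebraMap _ (IsSelfAdjoint.all q)).sub ha
  rw [ContinuousLinearMap.le_def, ContinuousLinearMap.isPositive_def', and_iff_right hsa]
  refine forall_congr' fun φ => ?_
  rw [← sub_nonneg (b := (inner ℂ (a φ) φ).re)]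
  have : ContinuousLinearMap.reApplyInnerSelf (algebraMap ℝ (H →L[ℂ] H) q - a) φ =
      q * ‖φ‖ ^ 2 - (inner ℂ (a φ) φ).re := by
    rw [ContinuousLinearMap.reApplyInnerSelf_apply, sub_apply, inner_sub_left,
      Algebra.algebraMap_eq_smul_one, smul_apply, one_apply_eq_self,
      inner_smul_left_eq_smul, map_sub, RCLike.smul_re, inner_self_eq_norm_sq]
    rfl
  rw [this]

/-- The spectrum of a self-adjoint operator is bounded above by `q` if and only if its numerical
range is. -/
theorem realSpectrum_le_iff {a : H →L[ℂ] H} (ha : IsSelfAdjoint a) (q : ℝ) :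
    (∀ E : ℝ, (E : ℂ) ∈ spectrum ℂ a → E ≤ q) ↔
      ∀ φ : H, (inner ℂ (a φ) φ).re ≤ q * ‖φ‖ ^ 2 := by
  rw [← le_algebraMap_iff_re_inner_le ha, le_algebraMap_iff_spectrum_le ha]
  refine forall_congr' fun E => ?_
  rw [← spectrum.algebraMap_mem_iff (S := ℂ)]
  rfl

theorem realSpectrum_nonempty [Nontrivial H] {a : H →L[ℂ] H} (ha : IsSelfAdjoint a) :
    {E : ℝ | (E : ℂ) ∈ spectrum ℂ a}.Nonempty := by
  obtain ⟨E, hE⟩ := ContinuousFunctionalCalculus.spectrum_nonempty (R := ℝ) a ha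
  exact ⟨E, (spectrum.algebraMap_mem_iff ℂ).2 hE⟩

theorem isCompact_realSpectrum (a : H →L[ℂ] H) :
    IsCompact {E : ℝ | (E : ℂ) ∈ spectrum ℂ a} :=
  Complex.isometry_ofReal.isClosedEmbedding.isCompact_preimage (spectrum.isCompact a)

end SelfAdjoint

/-! ### Quadratic form of the Hamiltonian and its dependence on the phase -/

theorem isSelfAdjoint_schrodinger (V : ℤ → ℝ) (M : ℝ) (hV : ∀ n, |V n| ≤ M) :
    IsSelfAdjoint (schrodinger V M hV) := by
  have hS (k : ℤ) (φ ψ : EllTwo) : inner ℂ (shift k φ) ψ = inner ℂ φ (shift (-k) ψ) := by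
    rw [lp.inner_eq_tsum, lp.inner_eq_tsum,
      ← (Equiv.addRight k).tsum_eq fun n => inner ℂ (φ n) (shift (-k) ψ n)]
    refine tsum_congr fun n => ?_
    change inner ℂ (φ (n + k)) (ψ n) = inner ℂ (φ (n + k)) (ψ (n + k + -k))
    rw [add_neg_cancel_right]
  have hM (φ ψ : EllTwo) : inner ℂ (mulPotential V M hV φ) ψ =
      inner ℂ φ (mulPotential V M hV ψ) := by
    rw [lp.inner_eq_tsum, lp.inner_eq_tsum]
    refine tsum_congr fun n => ?_
    change inner ℂ ((V n : ℂ) * φ n) (ψ n) = inner ℂ (φ n) ((V n : ℂ) * ψ n)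
    simp [RCLike.inner_apply]
    ring
  rw [ContinuousLinearMap.isSelfAdjoint_iff_isSymmetric]
  intro φ ψ
  change inner ℂ (shift 1 φ + shift (-1) φ + mulPotential V M hV φ) ψ =
    inner ℂ φ (shift 1 ψ + shift (-1) ψ + mulPotential V M hV ψ)
  simp only [inner_add_left, inner_add_right, hS, hM, neg_neg]
  ring

variable {Ω : Type*} [MetricSpace Ω] [CompactSpace Ω]

theorem re_inner_hamiltonian (T : Ω ≃ₜ Ω) (f : C(Ω, ℝ)) (ω : Ω) (φ : EllTwo) :
    (inner ℂ (hamiltonian T f ω φ) φ).re =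
      (inner ℂ (shift 1 φ + shift (-1) φ) φ).re + ∑' n, potential T f ω n * ‖φ n‖ ^ 2 := by
  change (inner ℂ (shift 1 φ + shift (-1) φ +
    mulPotential (potential T f ω) ‖f‖ (abs_potential_le T f ω) φ) φ).re = _
  rw [inner_add_left, Complex.add_re]
  congr 1
  rw [lp.inner_eq_tsum, Complex.re_tsum (lp.summable_inner _ _)]
  refine tsum_congr fun n => ?_
  change (inner ℂ ((potential T f ω n : ℂ) * φ n) (φ n)).re = _
  rw [← Complex.normSq_eq_norm_sq, Complex.normSq_apply]
  simp [RCLike.inner_apply]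
  ring

/-- The phases whose Hamiltonian is bounded above by `q`. -/
def lowSet (T : Ω ≃ₜ Ω) (f : C(Ω, ℝ)) (q : ℝ) : Set Ω :=
  {ω | ∀ φ : EllTwo, (inner ℂ (hamiltonian T f ω φ) φ).re ≤ q * ‖φ‖ ^ 2}

theorem mem_lowSet_iff_spec_le {T : Ω ≃ₜ Ω} {f : C(Ω, ℝ)} {q : ℝ} {ω : Ω} :
    ω ∈ lowSet T f q ↔ ∀ E ∈ spec T f ω, E ≤ q :=
  (realSpectrum_le_iff (isSelfAdjoint_schrodinger _ _ _) q).symm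

/-- For each fixed $\varphi$ the form is continuous in $\omega$: its potential part is a series of
continuous functions dominated by $\|f\|\,|\varphi(n)|^2$. The set is an intersection of closed
conditions. -/
theorem isClosed_lowSet (T : Ω ≃ₜ Ω) (f : C(Ω, ℝ)) (q : ℝ) : IsClosed (lowSet T f q) := by
  rw [lowSet, Set.ofPred_forall]
  refine isClosed_iInter fun φ => isClosed_le ?_ continuous_const
  simp only [re_inner_hamiltonian]
  refine continuous_const.add (continuous_tsum (u := fun n => ‖f‖ * ‖φ n‖ ^ 2) ?_ ?_ ?_)
  · intro n
    exact (f.continuous.comp (T ^ n).continuous).mul continuous_const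
  · have := (lp.memℓp φ).summable (by norm_num)
    simp only [ENNReal.toReal_ofNat, Real.rpow_ofNat] at this
    exact this.mul_left _
  · intro n ω
    rw [norm_mul, norm_pow, norm_norm]
    gcongr
    exact abs_potential_le T f ω n

theorem shift_hamiltonian (T : Ω ≃ₜ Ω) (f : C(Ω, ℝ)) (ω : Ω) (φ : EllTwo) :
    shift 1 (hamiltonian T f ω φ) = hamiltonian T f (T ω) (shift 1 φ) := by
  ext n
  change φ (n + 1 + 1) + φ (n + 1 - 1) + ((f ((T ^ (n + 1)) ω) : ℝ) : ℂ) * φ (n + 1) =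
    φ (n + 1 + 1) + φ (n - 1 + 1) + ((f ((T ^ n) (T ω)) : ℝ) : ℂ) * φ (n + 1)
  rw [zpow_add_one, Homeomorph.mul_apply, add_sub_cancel_right, sub_add_cancel]

theorem inner_shift_shift (k : ℤ) (φ ψ : EllTwo) :
    inner ℂ (shift k φ) (shift k ψ) = inner ℂ φ ψ := by
  rw [lp.inner_eq_tsum, lp.inner_eq_tsum]
  exact (Equiv.addRight k).tsum_eq fun n => inner ℂ (φ n) (ψ n)

/-- The unitary shift conjugates $H_\omega$ to $H_{T\omega}$, hence preserves form bounds. -/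
theorem preimage_lowSet (T : Ω ≃ₜ Ω) (f : C(Ω, ℝ)) (q : ℝ) :
    T ⁻¹' lowSet T f q = lowSet T f q := by
  ext ω
  have key (φ : EllTwo) : (inner ℂ (hamiltonian T f (T ω) (shift 1 φ)) (shift 1 φ)).re ≤
      q * ‖shift 1 φ‖ ^ 2 ↔ (inner ℂ (hamiltonian T f ω φ) φ).re ≤ q * ‖φ‖ ^ 2 := by
    rw [← shift_hamiltonian, inner_shift_shift]
    exact iff_of_eq (congrArg (fun r : ℝ => _ ≤ q * r ^ 2) (norm_shift 1 φ))
  constructor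
  · exact fun h φ => (key φ).1 (h _)
  · intro h φ
    have : shift 1 (shift (-1) φ) = φ := by
      ext n
      exact congrArg φ (add_neg_cancel_right n 1)
    rw [← this]
    exact (key _).2 (h _)

theorem lowSet_mono (T : Ω ≃ₜ Ω) (f : C(Ω, ℝ)) : Monotone (lowSet T f) :=
  fun _ _ hpq _ h φ => (h φ).trans (by gcongr)

/-! ### The almost sure top of the spectrum -/

theorem lowSet_norm (T : Ω ≃ₜ Ω) (f : C(Ω, ℝ)) (ω : Ω) :
    ω ∈ lowSet T f ‖hamiltonian T f ω‖ := by
  intro φ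
  calc (inner ℂ (hamiltonian T f ω φ) φ).re ≤ ‖hamiltonian T f ω φ‖ * ‖φ‖ :=
        re_inner_le_norm (𝕜 := ℂ) _ _
    _ ≤ ‖hamiltonian T f ω‖ * ‖φ‖ * ‖φ‖ := by gcongr; exact ContinuousLinearMap.le_opNorm _ _
    _ = _ := by ring

theorem spec_nonempty (T : Ω ≃ₜ Ω) (f : C(Ω, ℝ)) (ω : Ω) : (spec T f ω).Nonempty := by
  have : Nontrivial EllTwo := ⟨lp.single 2 0 1, 0, fun h => by
    have := congrArg (fun φ : EllTwo => φ 0) h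
    simp at this⟩
  exact realSpectrum_nonempty (isSelfAdjoint_schrodinger _ _ _)

theorem isCompact_spec (T : Ω ≃ₜ Ω) (f : C(Ω, ℝ)) (ω : Ω) : IsCompact (spec T f ω) :=
  isCompact_realSpectrum _

theorem norm_hamiltonian_le (T : Ω ≃ₜ Ω) (f : C(Ω, ℝ)) (ω : Ω) :
    ‖hamiltonian T f ω‖ ≤ 1 + 1 + ‖f‖ := by
  refine (norm_add₃_le ..).trans (add_le_add (add_le_add ?_ ?_) ?_)
  · exact LinearMap.mkContinuous_norm_le _ zero_le_one _
  · exact LinearMap.mkContinuous_norm_le _ zero_le_one _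
  · exact LinearMap.mkContinuous_norm_le _ (norm_nonneg _) _

/-- Almost surely, the spectrum is bounded above by `E_max`. -/
theorem ae_mem_lowSet_Emax [MeasurableSpace Ω] [BorelSpace Ω] (T : Ω ≃ₜ Ω) (f : C(Ω, ℝ))
    (μ : Measure Ω) [IsProbabilityMeasure μ] (hT : Ergodic T μ) :
    ∀ᵐ ω ∂μ, ω ∈ lowSet T f (Emax T f μ) := by
  have hmeas (q : ℝ) : MeasurableSet (lowSet T f q) := (isClosed_lowSet T f q).measurableSet
  have hzo (q : ℝ) : (∀ᵐ ω ∂μ, ω ∈ lowSet T f q) ∨ ∀ᵐ ω ∂μ, ω ∉ lowSet T f q :=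
    hT.toPreErgodic.ae_mem_or_ae_notMem (hmeas q) (preimage_lowSet T f q)
  have hnorm (ω : Ω) : ω ∈ lowSet T f (1 + 1 + ‖f‖) :=
    lowSet_mono T f (norm_hamiltonian_le T f ω) (lowSet_norm T f ω)
  have hlow {q : ℝ} {ω : Ω} (h : ω ∈ lowSet T f q) : -(1 + 1 + ‖f‖) ≤ q := by
    obtain ⟨E, hE⟩ := spec_nonempty T f ω
    refine le_trans ?_ (mem_lowSet_iff_spec_le.1 h E hE)
    have := (spectrum.norm_le_norm_mul_of_mem hE).trans
      ((mul_le_mul (norm_hamiltonian_le T f ω) ContinuousLinearMap.norm_id_le (norm_nonneg _)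
        (by positivity)).trans_eq (mul_one _))
    exact neg_le_of_abs_le this
  set S : Set ℝ := {q | ∀ᵐ ω ∂μ, ω ∈ lowSet T f q}
  have hne : S.Nonempty := ⟨1 + 1 + ‖f‖, ae_of_all μ hnorm⟩
  have hbdd : BddBelow S := ⟨-(1 + 1 + ‖f‖), fun q (hq : ∀ᵐ ω ∂μ, ω ∈ lowSet T f q) =>
    hlow hq.exists.choose_spec⟩
  obtain ⟨u, -, hu, huS⟩ := exists_seq_tendsto_sInf hne hbdd
  have hinf : ∀ᵐ ω ∂μ, ω ∈ lowSet T f (sInf S) := by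
    filter_upwards [ae_all_iff.2 huS] with ω hω φ
    exact ge_of_tendsto' (hu.mul_const _) fun n => hω n φ
  -- Below the infimum the zero-one law puts almost every phase outside `lowSet`. Countably many
  -- levels `v n` increasing to `sInf S` suffice to force $\max\sigma(H_\omega)=$ `sInf S` almost
  -- surely.
  obtain ⟨v, -, hvlt, hv⟩ := exists_seq_strictMono_tendsto (sInf S)
  have hnot (n : ℕ) : ∀ᵐ ω ∂μ, ω ∉ lowSet T f (v n) :=
    (hzo (v n)).resolve_left fun h => (csInf_le hbdd h).not_gt (hvlt n)
  have hmem : sInf S ∈ asSpec T f μ := by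
    filter_upwards [hinf, ae_all_iff.2 hnot] with ω hω hω'
    have hmax := (isCompact_spec T f ω).sSup_mem (spec_nonempty T f ω)
    have hle := mem_lowSet_iff_spec_le.1 hω _ hmax
    refine hle.lt_or_eq.elim (fun hlt => ?_) fun h => h ▸ hmax
    obtain ⟨n, hn⟩ := (hv.eventually (lt_mem_nhds hlt)).exists
    exact (hω' n (mem_lowSet_iff_spec_le.2 fun E hE =>
      (le_csSup (isCompact_spec T f ω).bddAbove hE).trans hn.le)).elim
  have hmax : IsGreatest (asSpec T f μ) (sInf S) := by
    refine ⟨hmem, fun E (hE : ∀ᵐ ω ∂μ, E ∈ spec T f ω) => ?_⟩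
    obtain ⟨ω, h1, h2⟩ := (hE.and hinf).exists
    exact mem_lowSet_iff_spec_le.1 h2 E h1
  rwa [Emax, hmax.csSup_eq]

/-! ### Bounded solutions on a half-line -/

open Finset in
theorem tsum_int_eq_sum_range {F : ℤ → ℝ} {M : ℕ} (hneg : ∀ n < 0, F n = 0)
    (hF : ∀ n : ℕ, M ≤ n → F n = 0) : ∑' n, F n = ∑ n ∈ range M, F n := by
  rw [tsum_eq_sum (s := (range M).map Nat.castEmbedding), sum_map]
  · rfl
  · intro n hn
    rcases lt_or_ge n 0 with h | h
    · exact hneg n h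
    · lift n to ℕ using h
      exact hF n (not_lt.1 fun h => hn (mem_map.2 ⟨n, mem_range.2 h, rfl⟩))

/-- A finitely supported sequence on `ℕ`, extended by zero to an element of `ℓ²(ℤ)`. -/
theorem exists_extension_by_zero {w : ℕ → ℝ} {M : ℕ} (hw : ∀ n, M ≤ n → w n = 0) :
    ∃ φ : EllTwo, (∀ n : ℕ, φ n = w n) ∧ ∀ n < 0, φ n = 0 := by
  refine ⟨⟨fun n => if 0 ≤ n then (w n.toNat : ℂ) else 0, ?_⟩, ?_, ?_⟩
  · refine (memℓp_zero ((Set.finite_Ico 0 (M : ℤ)).subset fun n hn => ?_)).of_exponent_ge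
      zero_le
    by_contra h
    refine hn ?_
    split_ifs with h0
    · rw [hw, Complex.ofReal_zero]
      simp only [Set.mem_Ico, h0, true_and, not_lt] at h
      omega
    · rfl
  · intro n
    change (if (0 : ℤ) ≤ n then (w (n : ℤ).toNat : ℂ) else 0) = w n
    simp
  · intro n hn
    exact if_neg hn.not_ge

open Finset in
/-- The quadratic form of the Hamiltonian on sequences supported on a half-line. -/
theorem halfLine_form_le {T : Ω ≃ₜ Ω} {f : C(Ω, ℝ)} {q : ℝ} {ω : Ω} (hω : ω ∈ lowSet T f q)
    {w : ℕ → ℝ} {M : ℕ} (hw : ∀ n, M ≤ n → w n = 0) :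
    ∑ n ∈ range M, (2 * w n * w (n + 1) + (potential T f ω n - q) * w n ^ 2) ≤ 0 := by
  obtain ⟨φ, hφ, hφ0⟩ := exists_extension_by_zero hw
  have hnorm : ‖φ‖ ^ 2 = ∑ n ∈ range M, w n ^ 2 := by
    have h := lp.norm_rpow_eq_tsum (p := 2) (by norm_num) φ
    simp only [ENNReal.toReal_ofNat, Real.rpow_ofNat] at h
    rw [h, tsum_int_eq_sum_range (M := M)]
    · simp [hφ]
    · intro n hn
      simp [hφ0 n hn]
    · intro n hn
      simp [hφ, hw n hn]
  have hinner : (inner ℂ (hamiltonian T f ω φ) φ).re =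
      ∑ n ∈ range M, ((φ (n + 1)).re + (φ (n - 1)).re + potential T f ω n * w n) * w n := by
    rw [lp.inner_eq_tsum, Complex.re_tsum (lp.summable_inner _ _),
      tsum_int_eq_sum_range (M := M)]
    · refine sum_congr rfl fun n _ => ?_
      rw [hφ, hamiltonian, schrodinger_apply, hφ]
      simp [RCLike.inner_apply]
      ring
    · intro n hn
      simp [hφ0 n hn]
    · intro n hn
      simp [hφ, hw n hn]
  have hsucc (n : ℕ) : (φ ((n : ℤ) + 1)).re = w (n + 1) := by
    have := hφ (n + 1)
    push_cast at this
    rw [this, Complex.ofReal_re]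
  have hshift : ∑ n ∈ range M, (φ ((n : ℤ) - 1)).re * w n =
      ∑ n ∈ range M, w n * w (n + 1) := by
    -- The sum over `range (M + 1)` is peeled at both ends: the top term vanishes as `w M = 0`, the
    -- bottom one as `φ (-1) = 0`.
    have h := sum_range_succ (fun n : ℕ => (φ ((n : ℤ) - 1)).re * w n) M
    rw [sum_range_succ', hw M le_rfl, mul_zero, add_zero] at h
    rw [← h, Nat.cast_zero, hφ0 _ (by norm_num), Complex.zero_re, zero_mul, add_zero]
    refine sum_congr rfl fun n _ => ?_
    rw [Nat.cast_succ, add_sub_cancel_right, hφ, Complex.ofReal_re]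
  have h := hω φ
  simp only [hinner, hnorm, add_mul, sum_add_distrib, hshift, hsucc, mul_sum] at h
  have hsplit : ∑ n ∈ range M, (2 * w n * w (n + 1) + (potential T f ω n - q) * w n ^ 2) =
      ∑ n ∈ range M, w (n + 1) * w n + ∑ n ∈ range M, w n * w (n + 1) +
        ∑ n ∈ range M, potential T f ω n * w n * w n - ∑ n ∈ range M, q * w n ^ 2 := by
    rw [← sum_add_distrib, ← sum_add_distrib, ← sum_sub_distrib]
    exact sum_congr rfl fun n _ => by ring
  rw [hsplit]
  linarith

open Finset in
/-- Summation by parts for a truncated solution `χ u` of the difference equation. -/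
theorem sum_truncated_solution {u v χ : ℕ → ℝ} {q : ℝ}
    (hu : ∀ n, u (n + 2) = (q - v (n + 1)) * u (n + 1) - u n) (K : ℕ) :
    ∑ n ∈ range K, (2 * (χ n * u (n + 1)) * (χ (n + 1) * u (n + 2)) +
        (v (n + 1) - q) * (χ n * u (n + 1)) ^ 2) =
      χ K ^ 2 * (u K * u (K + 1)) - χ 0 ^ 2 * (u 0 * u 1) -
        ∑ n ∈ range K, u (n + 1) * u (n + 2) * (χ n - χ (n + 1)) ^ 2 := by
  induction K with
  | zero => simp
  | succ K ih =>
    rw [sum_range_succ, sum_range_succ, ih]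
    have h : v (K + 1) * u (K + 1) = q * u (K + 1) - u K - u (K + 2) := by
      rw [hu]
      ring
    linear_combination χ K ^ 2 * u (K + 1) * h

-- The form is tested on $(t,\chi_0u_1,\chi_1u_2,\dots)$ with a cutoff $\chi$ falling linearly from
-- $1$ to $0$ in $K+1$ steps. Summation by parts leaves the boundary term $u_0u_1$ and an error at
-- most $(K+1)\,B^2/(K+1)^2$, which vanishes as $K\to\infty$.
open Finset in
theorem two_mul_sub_le_of_bounded {T : Ω ≃ₜ Ω} {f : C(Ω, ℝ)} {q : ℝ} {ω : Ω}
    (hω : ω ∈ lowSet T f q) {u : ℕ → ℝ} {B : ℝ}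
    (hu : ∀ n : ℕ, u (n + 2) = (q - potential T f ω (n + 1 : ℕ)) * u (n + 1) - u n)
    (hB : ∀ n, |u n| ≤ B) (t : ℝ) :
    2 * t * u 1 - (q - potential T f ω 0) * t ^ 2 ≤ u 0 * u 1 := by
  have key (K : ℕ) : 2 * t * u 1 - (q - potential T f ω 0) * t ^ 2 ≤
      u 0 * u 1 + B ^ 2 * (1 / ((K : ℝ) + 1)) := by
    set χ : ℕ → ℝ := fun n => max (1 - n / ((K : ℝ) + 1)) 0
    have hK : (0 : ℝ) < K + 1 := by positivity
    have hχ0 : χ 0 = 1 := by simp [χ]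
    have hχ (n : ℕ) (hn : K + 1 ≤ n) : χ n = 0 := by
      refine max_eq_right ?_
      rw [sub_nonpos, one_le_div hK]
      exact_mod_cast hn
    have hd (n : ℕ) : |χ n - χ (n + 1)| ≤ 1 / ((K : ℝ) + 1) := by
      refine (abs_max_sub_max_le_abs _ _ _).trans_eq ?_
      rw [show (1 - (n : ℝ) / ((K : ℝ) + 1)) - (1 - ((n + 1 : ℕ) : ℝ) / ((K : ℝ) + 1)) =
        1 / ((K : ℝ) + 1) by push_cast; ring]
      exact abs_of_pos (by positivity)
    have h := halfLine_form_le hω (M := K + 2)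
      (w := fun n => Nat.casesOn n t fun n => χ n * u (n + 1)) (by
        intro n hn
        obtain ⟨n, rfl⟩ : ∃ m, n = m + 1 := ⟨n - 1, by omega⟩
        exact (congrArg (· * u (n + 1)) (hχ n (by omega))).trans (zero_mul _))
    rw [sum_range_succ'] at h
    have hs := sum_truncated_solution (v := fun n => potential T f ω n) (χ := χ) hu (K + 1)
    rw [hχ _ le_rfl, hχ0] at hs
    have hle : ∑ n ∈ range (K + 1), u (n + 1) * u (n + 2) * (χ n - χ (n + 1)) ^ 2 ≤
        B ^ 2 * (1 / ((K : ℝ) + 1)) := by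
      calc _ ≤ ∑ n ∈ range (K + 1), B ^ 2 * (1 / ((K : ℝ) + 1)) ^ 2 := by
            refine sum_le_sum fun n _ => mul_le_mul ?_ ?_ (sq_nonneg _) (sq_nonneg _)
            · refine (le_abs_self _).trans ?_
              rw [abs_mul, sq]
              exact mul_le_mul (hB _) (hB _) (abs_nonneg _) ((abs_nonneg _).trans (hB 0))
            · exact sq_le_sq' (neg_le_of_abs_le (hd n)) (le_of_abs_le (hd n))
        _ = B ^ 2 * (1 / ((K : ℝ) + 1)) := by
            rw [sum_const, card_range, nsmul_eq_mul]
            push_cast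
            field_simp
    have h' : ∑ n ∈ range (K + 1), (2 * (χ n * u (n + 1)) * (χ (n + 1) * u (n + 2)) +
        (potential T f ω (n + 1 : ℕ) - q) * (χ n * u (n + 1)) ^ 2) +
        (2 * t * (χ 0 * u 1) + (potential T f ω 0 - q) * t ^ 2) ≤ 0 := h
    rw [hs, hχ0] at h'
    linarith
  have hlim : Filter.Tendsto (fun K : ℕ => u 0 * u 1 + B ^ 2 * (1 / ((K : ℝ) + 1)))
      Filter.atTop (nhds (u 0 * u 1)) := by
    simpa using (tendsto_one_div_add_atTop_nhds_zero_nat (𝕜 := ℝ)).const_mul (B ^ 2)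
      |>.const_add (u 0 * u 1)
  exact ge_of_tendsto' hlim key

/-- A bounded solution at an energy above the spectrum does not change sign. -/
theorem mul_pos_of_bounded {T : Ω ≃ₜ Ω} {f : C(Ω, ℝ)} {q : ℝ} {ω : Ω}
    (hω : ω ∈ lowSet T f q) {u : ℕ → ℝ} {B : ℝ}
    (hu : ∀ n : ℕ, u (n + 2) = (q - potential T f ω (n + 1 : ℕ)) * u (n + 1) - u n)
    (hB : ∀ n, |u n| ≤ B) (h1 : u 1 ≠ 0) : 0 < u 0 * u 1 := by
  set a := q - potential T f ω 0 with ha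
  -- The choice $t=su_1$ gives $2tu_1-at^2=su_1^2(2-as)$, positive because $as<1$.
  set s := 1 / (|a| + 1) with hs
  have hs0 : 0 < s := by positivity
  have has : a * s < 1 := by
    rw [hs, mul_one_div, div_lt_one (by positivity)]
    linarith [le_abs_self a]
  refine lt_of_lt_of_le ?_ (two_mul_sub_le_of_bounded hω hu hB (s * u 1))
  rw [← ha]
  have : 2 * (s * u 1) * u 1 - a * (s * u 1) ^ 2 = s * u 1 ^ 2 * (2 - a * s) := by ring
  rw [this]
  have := pow_pos (abs_pos.2 h1) 2
  rw [sq_abs] at this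
  exact mul_pos (mul_pos hs0 this) (by linarith)

/-- Along an orbit the first coordinates of an invariant section solve the difference equation, and
the second coordinate is the preceding value of the solution. -/
theorem mul_pos_of_invariant_section {T : Ω ≃ₜ Ω} {f : C(Ω, ℝ)} {q : ℝ} {ω : Ω}
    (hω : ω ∈ lowSet T f q) {g : Ω → Fin 2 → ℝ} {B : ℝ}
    (hg : ∀ ω, (cocycleMap f q ω).1.mulVec (g ω) = g (T ω))
    (hB : ∀ ω, |g ω 0| ≤ B) (h0 : g ω 0 ≠ 0) : 0 < g ω 1 * g ω 0 := by
  have hg0 (ω : Ω) : g (T ω) 0 = (q - f ω) * g ω 0 - g ω 1 := by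
    rw [← hg]
    simp [cocycleMap, Matrix.mulVec, dotProduct, Fin.sum_univ_two]
    ring
  have hg1 (ω : Ω) : g (T ω) 1 = g ω 0 := by
    rw [← hg]
    simp [cocycleMap, Matrix.mulVec, dotProduct, Fin.sum_univ_two]
  -- Starting one step back makes the two coordinates at the given phase equal to `u 1` and `u 0`.
  obtain ⟨ω, rfl⟩ := T.surjective ω
  have hω' : ω ∈ lowSet T f q := by
    rw [← preimage_lowSet]
    exact hω
  have hT (n : ℕ) : (T ^ (n + 1)) ω = T ((T ^ n) ω) := by
    rw [pow_succ', Homeomorph.mul_apply]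
  have h := mul_pos_of_bounded hω' (u := fun n => g ((T ^ n) ω) 0) (B := B) (fun n => by
    rw [potential, zpow_natCast, hT (n + 1), hg0, hT n, hg1]) (fun n => hB _)
    (by simpa using h0)
  rw [hg1]
  simpa using h

omit [CompactSpace Ω] in
theorem skewProduct_zpow_section {T : Ω ≃ₜ Ω}
    {A : Ω → Matrix.SpecialLinearGroup (Fin 2) ℝ} {g : Ω → Fin 2 → ℝ}
    (hg : ∀ ω, (A ω).1.mulVec (g ω) = g (T ω)) (s : ℝ) (n : ℤ) (ω : Ω) :
    (skewProduct T A ^ n) (ω, s • g ω) = ((T ^ n) ω, s • g ((T ^ n) ω)) := by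
  have hone (ω : Ω) : skewProduct T A (ω, s • g ω) = (T ω, s • g (T ω)) := by
    change (T ω, (A ω).1.mulVec (s • g ω)) = _
    rw [Matrix.mulVec_smul, hg]
  induction n with
  | zero => simp
  | succ n ih =>
    rw [add_comm, zpow_one_add, zpow_one_add, Equiv.Perm.mul_apply, ih, hone, Homeomorph.mul_apply]
  | pred n ih =>
    rw [sub_eq_neg_add, zpow_add, zpow_add, Equiv.Perm.mul_apply, ih, zpow_neg_one, zpow_neg_one,
      Equiv.Perm.inv_eq_iff_eq, hone, Homeomorph.mul_apply]
    change _ = (T (T.symm _), s • g (T (T.symm _)))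
    rw [T.apply_symm_apply]

/-! ### Compact cones in the open quadrant -/

theorem isCompactConeInQuadrant_of_bounds {m : ℝ} (hm : 0 < m) (M : ℝ) :
    IsCompactConeInQuadrant
      {v : Fin 2 → ℝ | 0 ≤ v 0 ∧ 0 ≤ v 1 ∧ m * v 0 ≤ M * v 1 ∧ m * v 1 ≤ M * v 0} where
  zero_mem := by simp
  convex := by
    rintro x ⟨hx0, hx1, hx, hx'⟩ y ⟨hy0, hy1, hy, hy'⟩ a b ha hb -
    simp only [Set.mem_ofPred_eq, Pi.add_apply, Pi.smul_apply, smul_eq_mul]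
    refine ⟨by positivity, by positivity, ?_, ?_⟩
    · linarith [mul_le_mul_of_nonneg_left hx ha, mul_le_mul_of_nonneg_left hy hb]
    · linarith [mul_le_mul_of_nonneg_left hx' ha, mul_le_mul_of_nonneg_left hy' hb]
  smul_mem := by
    rintro v ⟨h0, h1, h, h'⟩ t ht
    simp only [Set.mem_ofPred_eq, Pi.smul_apply, smul_eq_mul]
    refine ⟨by positivity, by positivity, ?_, ?_⟩
    · linarith [mul_le_mul_of_nonneg_left h ht]
    · linarith [mul_le_mul_of_nonneg_left h' ht]
  compact := by
    refine (isCompact_sphere (0 : Fin 2 → ℝ) 1).inter_left ?_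
    have h0 : Continuous fun v : Fin 2 → ℝ => v 0 := continuous_apply 0
    have h1 : Continuous fun v : Fin 2 → ℝ => v 1 := continuous_apply 1
    exact (isClosed_le continuous_const h0).inter ((isClosed_le continuous_const h1).inter
      ((isClosed_le (h0.const_mul m) (h1.const_mul M)).inter
        (isClosed_le (h1.const_mul m) (h0.const_mul M))))
  quadrant := by
    rintro v ⟨h0, h1, h, h'⟩ hv
    by_contra hcon
    refine hv ?_
    have h00 : v 0 = 0 ∧ v 1 = 0 := by
      rcases h0.eq_or_lt with h0' | h0'
      · rw [← h0', mul_zero] at h'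
        exact ⟨h0'.symm, le_antisymm (nonpos_of_mul_nonpos_right h' hm) h1⟩
      · rcases h1.eq_or_lt with h1' | h1'
        · rw [← h1', mul_zero] at h
          exact ⟨le_antisymm (nonpos_of_mul_nonpos_right h hm) h0, h1'.symm⟩
        · exact (hcon ⟨h0', h1'⟩).elim
    ext i
    fin_cases i
    · exact h00.1
    · exact h00.2

/-- A continuous map into the open first quadrant from a compact space takes values in a compact
cone. -/
theorem exists_compactCone [Nonempty Ω] {b : Ω → Fin 2 → ℝ} (hb : Continuous b)
    (hpos : ∀ ω i, 0 < b ω i) :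
    ∃ C, IsCompactConeInQuadrant C ∧ ∀ ω, b ω ∈ C \ {0} := by
  have hc (i : Fin 2) : Continuous fun ω => b ω i := (continuous_apply i).comp hb
  obtain ⟨ω₁, -, h₁⟩ := isCompact_univ.exists_isMinOn Set.univ_nonempty
    ((hc 0).min (hc 1)).continuousOn
  obtain ⟨ω₂, -, h₂⟩ := isCompact_univ.exists_isMaxOn Set.univ_nonempty
    ((hc 0).max (hc 1)).continuousOn
  have hm : 0 < min (b ω₁ 0) (b ω₁ 1) := lt_min (hpos _ _) (hpos _ _)
  have hM : 0 < max (b ω₂ 0) (b ω₂ 1) := lt_max_of_lt_left (hpos _ _)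
  refine ⟨_, isCompactConeInQuadrant_of_bounds hm (max (b ω₂ 0) (b ω₂ 1)),
    fun ω => ⟨?_, fun h => ?_⟩⟩
  · have h1 := le_min_iff.1 (isMinOn_iff.1 h₁ ω trivial)
    have h2 := max_le_iff.1 (isMaxOn_iff.1 h₂ ω trivial)
    refine ⟨(hpos ω 0).le, (hpos ω 1).le, ?_, ?_⟩
    · rw [mul_comm]
      exact mul_le_mul h2.1 h1.2 hm.le hM.le
    · rw [mul_comm]
      exact mul_le_mul h2.2 h1.1 hm.le hM.le
  · exact (hpos ω 0).ne' (congrFun h 0)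

/-! ### Invariant sections from the parabolic conjugacy -/

omit [CompactSpace Ω] in
theorem conj_mulVec {T : Ω ≃ₜ Ω} {A W : Ω → Matrix.SpecialLinearGroup (Fin 2) ℝ} {c : ℝ}
    (hconj : ∀ ω, (W (T ω))⁻¹ * A ω * W ω = parabolic c) {v : Fin 2 → ℝ}
    (hv : (parabolic c).1.mulVec v = v) (ω : Ω) :
    (A ω).1.mulVec ((W ω).1.mulVec v) = (W (T ω)).1.mulVec v := by
  have h : A ω * W ω = W (T ω) * parabolic c := by
    rw [← hconj ω]
    group
  nth_rw 2 [← hv]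
  rw [Matrix.mulVec_mulVec, Matrix.mulVec_mulVec, ← Matrix.SpecialLinearGroup.coe_mul,
    ← Matrix.SpecialLinearGroup.coe_mul, h]

omit [CompactSpace Ω] in
theorem continuous_mulVec {W : Ω → Matrix.SpecialLinearGroup (Fin 2) ℝ} (hW : Continuous W)
    (v : Fin 2 → ℝ) : Continuous fun ω => (W ω).1.mulVec v :=
  (continuous_subtype_val.comp hW).matrix_mulVec continuous_const

theorem exists_abs_apply_le [Nonempty Ω] {g : Ω → Fin 2 → ℝ} (hg : Continuous g) :
    ∃ B, ∀ ω i, |g ω i| ≤ B := by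
  obtain ⟨B, hB⟩ := isCompact_univ.exists_bound_of_continuousOn hg.continuousOn
  exact ⟨B, fun ω i => (norm_le_pi_norm (g ω) i).trans (hB ω trivial)⟩

theorem parabolic_ne_zero {T : Ω ≃ₜ Ω} {f : C(Ω, ℝ)} {q c : ℝ} {ω : Ω}
    (hω : ω ∈ lowSet T f q) {W : Ω → Matrix.SpecialLinearGroup (Fin 2) ℝ} (hW : Continuous W)
    (hconj : ∀ ω, (W (T ω))⁻¹ * cocycleMap f q ω * W ω = parabolic c) : c ≠ 0 := by
  rintro rfl
  have : Nonempty Ω := ⟨ω⟩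
  have hpar : (parabolic 0).1 = 1 := Matrix.one_fin_two.symm
  -- With $c=0$ every constant vector is fixed, so a section may be prescribed at $\omega$; the
  -- value $(1,0)$ has coordinate product $0$.
  set v := (W ω)⁻¹.1.mulVec ![1, 0]
  obtain ⟨B, hB⟩ := exists_abs_apply_le (continuous_mulVec hW v)
  have hωv : (W ω).1.mulVec v = ![1, 0] := by
    rw [Matrix.mulVec_mulVec, ← Matrix.SpecialLinearGroup.coe_mul, mul_inv_cancel,
      Matrix.SpecialLinearGroup.coe_one, Matrix.one_mulVec]
  have h := mul_pos_of_invariant_section hω (g := fun ω => (W ω).1.mulVec v)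
    (conj_mulVec hconj (by rw [hpar, Matrix.one_mulVec])) (fun ω => hB ω 0) (by simp [hωv])
  simp [hωv] at h

theorem exists_positive_section [Nonempty Ω] {T : Ω ≃ₜ Ω} {f : C(Ω, ℝ)} {q c : ℝ}
    (hlow : ∀ ω, ω ∈ lowSet T f q) {W : Ω → Matrix.SpecialLinearGroup (Fin 2) ℝ}
    (hW : Continuous W)
    (hconj : ∀ ω, (W (T ω))⁻¹ * cocycleMap f q ω * W ω = parabolic c) :
    ∃ g : Ω → Fin 2 → ℝ, Continuous g ∧
      (∀ ω, (cocycleMap f q ω).1.mulVec (g ω) = g (T ω)) ∧ ∀ ω, 0 < g ω 1 * g ω 0 := by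
  set e : Fin 2 → ℝ := ![1, 0]
  have he : (parabolic c).1.mulVec e = e := by
    ext i
    fin_cases i <;> simp [parabolic, e, Matrix.mulVec, dotProduct, Fin.sum_univ_two]
  set g : Ω → Fin 2 → ℝ := fun ω => (W ω).1.mulVec e
  have hgc : Continuous g := continuous_mulVec hW e
  have hg (ω : Ω) : (cocycleMap f q ω).1.mulVec (g ω) = g (T ω) := conj_mulVec hconj he ω
  obtain ⟨B, hB⟩ := exists_abs_apply_le hgc
  have hpos (ω : Ω) (h0 : g ω 0 ≠ 0) : 0 < g ω 1 * g ω 0 :=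
    mul_pos_of_invariant_section (hlow ω) hg (fun ω => hB ω 0) h0
  -- If the first coordinate vanishes at $\omega$, then $g(T\omega)=(-g_1(\omega),0)$. Positivity at
  -- $T\omega$ forces $g_1(\omega)=0$, so $g(\omega)=0$, impossible since $W(\omega)$ is invertible.
  refine ⟨g, hgc, hg, fun ω => hpos ω fun h0 => ?_⟩
  have hg0 : g (T ω) 0 = -g ω 1 := by
    rw [← hg]
    simp [cocycleMap, Matrix.mulVec, dotProduct, Fin.sum_univ_two, h0]
  have hg1 : g (T ω) 1 = 0 := by
    rw [← hg]
    simp [cocycleMap, Matrix.mulVec, dotProduct, Fin.sum_univ_two, h0]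
  have h1 : g ω 1 = 0 := by
    by_contra h1
    have := hpos (T ω) (by rwa [hg0, neg_ne_zero])
    rw [hg1, zero_mul] at this
    exact lt_irrefl _ this
  have hgω : g ω = 0 := by
    ext i
    fin_cases i
    · exact h0
    · exact h1
  have heq : e = (W ω)⁻¹.1.mulVec (g ω) := by
    rw [Matrix.mulVec_mulVec, ← Matrix.SpecialLinearGroup.coe_mul, inv_mul_cancel,
      Matrix.SpecialLinearGroup.coe_one, Matrix.one_mulVec]
  rw [hgω, Matrix.mulVec_zero] at heq
  exact one_ne_zero (congrFun heq 0)

theorem exists_cone_section [Nonempty Ω] {T : Ω ≃ₜ Ω} {f : C(Ω, ℝ)} {q c : ℝ}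
    (hlow : ∀ ω, ω ∈ lowSet T f q) {W : Ω → Matrix.SpecialLinearGroup (Fin 2) ℝ}
    (hW : Continuous W)
    (hconj : ∀ ω, (W (T ω))⁻¹ * cocycleMap f q ω * W ω = parabolic c) :
    ∃ C : Set (Fin 2 → ℝ), IsCompactConeInQuadrant C ∧
      ∃ b : Ω → (Fin 2 → ℝ), Continuous b ∧ (∀ ω, b ω ∈ C \ {0}) ∧
        (∀ ω, ∃ (h₁ : b (T ω) ≠ 0) (h₂ : (cocycleMap f q ω).1.mulVec (b ω) ≠ 0),
          Projectivization.mk ℝ (b (T ω)) h₁ =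
            Projectivization.mk ℝ ((cocycleMap f q ω).1.mulVec (b ω)) h₂) ∧
        (∀ ω, Bornology.IsBounded (Set.range fun n : ℤ =>
          iterate T (cocycleMap f q) n ω (b ω))) := by
  obtain ⟨g, hgc, hg, hpos⟩ := exists_positive_section hlow hW hconj
  -- At each phase $b=\pm g$. The sign may vary with $\omega$, so invariance of $b$ holds only
  -- projectively; absolute values keep $b$ continuous.
  set b : Ω → Fin 2 → ℝ := fun ω i => |g ω i| with hb
  have hbc : Continuous b := continuous_pi fun i => ((continuous_apply i).comp hgc).abs
  have hbpos (ω : Ω) (i : Fin 2) : 0 < b ω i := by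
    refine abs_pos.2 fun h => (hpos ω).ne' ?_
    fin_cases i
    · exact mul_eq_zero_of_right _ h
    · exact mul_eq_zero_of_left h _
  have hsign (ω : Ω) : ∃ s : ℝ, s * s = 1 ∧ b ω = s • g ω := by
    rcases pos_and_pos_or_neg_and_neg_of_mul_pos (hpos ω) with ⟨h1, h0⟩ | ⟨h1, h0⟩
    · refine ⟨1, by norm_num, ?_⟩
      ext i
      fin_cases i
      · simp [hb, abs_of_pos h0]
      · simp [hb, abs_of_pos h1]
    · refine ⟨-1, by norm_num, ?_⟩
      ext i
      fin_cases i
      · simp [hb, abs_of_neg h0]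
      · simp [hb, abs_of_neg h1]
  obtain ⟨C, hC, hbC⟩ := exists_compactCone hbc hbpos
  have hb0 (ω : Ω) : b ω ≠ 0 := (hbC ω).2
  refine ⟨C, hC, b, hbc, hbC, fun ω => ?_, fun ω => ?_⟩
  · obtain ⟨s, hs, hbs⟩ := hsign ω
    obtain ⟨s', hs', hbs'⟩ := hsign (T ω)
    have hrel : (s' * s) • (cocycleMap f q ω).1.mulVec (b ω) = b (T ω) := by
      rw [hbs, Matrix.mulVec_smul, hg, smul_smul, mul_assoc, hs, mul_one, hbs']
    refine ⟨hb0 _, fun h => hb0 (T ω) ?_, ?_⟩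
    · rw [← hrel, h, smul_zero]
    · exact (Projectivization.mk_eq_mk_iff' ℝ _ _ _ _).2 ⟨_, hrel⟩
  · obtain ⟨s, -, hbs⟩ := hsign ω
    refine ((isCompact_range (hgc.const_smul s)).isBounded).subset ?_
    rintro _ ⟨n, rfl⟩
    refine ⟨(T ^ n) ω, ?_⟩
    change s • g ((T ^ n) ω) = ((skewProduct T (cocycleMap f q) ^ n) (ω, b ω)).2
    rw [hbs, skewProduct_zpow_section hg]

end DynSchrodinger

theorem corollaryc {Ω : Type*} [MetricSpace Ω] [CompactSpace Ω] [MeasurableSpace Ω] [BorelSpace Ω]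
    (T : Ω ≃ₜ Ω) (μ : Measure Ω) [IsProbabilityMeasure μ] (hT : Ergodic T μ) (f : C(Ω, ℝ))
    (c : ℝ) (W : Ω → Matrix.SpecialLinearGroup (Fin 2) ℝ) (hW : Continuous W)
    (hconj : ∀ ω, (W (T ω))⁻¹ * DynSchrodinger.cocycleMap f (DynSchrodinger.Emax T f μ) ω * W ω =
      DynSchrodinger.parabolic c) :
    c ≠ 0 ∧
    ((μ.IsOpenPosMeasure ∨
        ∀ ω, ∀ E ∈ DynSchrodinger.spec T f ω, E ≤ DynSchrodinger.Emax T f μ) →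
      ∃ C : Set (Fin 2 → ℝ), DynSchrodinger.IsCompactConeInQuadrant C ∧
      ∃ b : Ω → (Fin 2 → ℝ), Continuous b ∧ (∀ ω, b ω ∈ C \ {0}) ∧
        (∀ ω, ∃ (h₁ : b (T ω) ≠ 0)
          (h₂ : (DynSchrodinger.cocycleMap f (DynSchrodinger.Emax T f μ) ω).1.mulVec (b ω) ≠ 0),
          Projectivization.mk ℝ (b (T ω)) h₁ =
            Projectivization.mk ℝ
              ((DynSchrodinger.cocycleMap f (DynSchrodinger.Emax T f μ) ω).1.mulVec (b ω)) h₂) ∧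
        (∀ ω, Bornology.IsBounded (Set.range fun n : ℤ =>
          DynSchrodinger.iterate T
            (DynSchrodinger.cocycleMap f (DynSchrodinger.Emax T f μ)) n ω (b ω)))) := by
  have hae := DynSchrodinger.ae_mem_lowSet_Emax T f μ hT
  obtain ⟨ω₀, hω₀⟩ := hae.exists
  have : Nonempty Ω := ⟨ω₀⟩
  refine ⟨DynSchrodinger.parabolic_ne_zero hω₀ hW hconj, fun h => ?_⟩
  refine DynSchrodinger.exists_cone_section (fun ω => ?_) hW hconj
  rcases h with h | h
  -- Under full support a set of full measure is dense, and `lowSet` is closed, so it contains every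
  -- phase.
  · have hdense := Measure.dense_of_ae hae
    exact (DynSchrodinger.isClosed_lowSet T f _).closure_subset (hdense ω)
  · exact DynSchrodinger.mem_lowSet_iff_spec_le.2 (h ω)
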